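/- Let $Q$ be a smooth (Hausdorff, finite-dimensional) manifold without boundary, let $\pi:T^*Q\to Q$ be its cotangent bundle with fundamental one-form $\vartheta_0(X)=\langle p,d\pi X\rangle$ for $X\in T_p(T^*Q)$ and symplectic form $\omega=d\vartheta_0$. For $f\in C^\infty(T^*Q)$ let $X_f$ be the Hamiltonian vector field, $\omega(X_f,\cdot)=-df$, and let $\{f_1,f_2\}=-X_{f_1}f_2$ be the Poisson bracket. Let $l\in C^\infty(TQ)$ be a Lagrangian (possibly degenerate) with Legendre transformation $\mathscr L:TQ\to T^*Q$, $\langle\mathscr L(v),w\rangle=\frac{d}{dt}\big|_{t=0}l(v+tw)$. Let $\mathscr D\subseteq TQ$ be the set of all vectors $\dot\gamma(0)$, where $\gamma:(-\epsilon,\epsilon)\to Q$, for some $\epsilon>0$, is a smooth solution of the Euler–Lagrange equations of $l$, and let $\mathscr C=\mathscr L(\mathscr D)\subseteq T^*Q$ be the constraint set. A constraint function is a function $c\in C^\infty(T^*Q)$ that vanishes on $\mathscr C$; a function $f\in C^\infty(T^*Q)$ is first class if $\{f,c\}$ is a constraint function for every constraint function $c$. Let a (finite-dimensional) Lie group $G$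 with Lie algebra $\mathfrak g$ act smoothly on $Q$ by $\phi_g(q)=g\cdot q$. Let $\phi'_g=T\phi_g$ be the lifted action on $TQ$, and $\tilde\phi$ the lifted action on $T^*Q$, $\langle\tilde\phi_g(p),v\rangle=\langle p,\phi'_{g^{-1}}(v)\rangle$. For $\xi\in\mathfrak g$ let $\xi_{T^*Q}$ be the vector field on $T^*Q$ that generates the action of the one-parameter subgroup $\exp t\xi$ by $\tilde\phi$, and let $j_\xi=\langle\vartheta_0,\xi_{T^*Q}\rangle$ be the corresponding component of the momentum map of $\tilde\phi$. Suppose that $G$ is a symmetry group of $l$, that is, $l\circ\phi'_g=l$ for all $g\in G$. Then, for every $\xi\in\mathfrak g$: 1. $X_{j_\xi}=\xi_{T^*Q}$; 2. $j_\xi\in C^\infty(T^*Q)$ is a first class function; 3. the local flow of $X_{j_\xi}$ preserves $\mathscr C$: an integral curve of $X_{j_\xi}$, defined on an open interval, that meets $\mathscr C$ is contained in $\mathscr C$. -/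

import Mathlib

open Set Bundle
open scoped Manifold ContDiff

noncomputable section

/-! Constrained Lagrangian mechanics on a smooth manifold `Q` modelled on a finite-dimensional real
vector space `E` (no boundary). -/

section ExteriorDerivative

variable {V : Type*} [NormedAddCommGroup V] [NormedSpace ℝ V] {H : Type*} [TopologicalSpace H]
  (I : ModelWithCorners ℝ V H) {M : Type*} [TopologicalSpace M] [ChartedSpace H M]

/-- The coordinate expression of the one-form `α` on `M` in the preferred chart around `x₀`:
the pull-back of `α` by the inverse of that chart. -/
def oneFormInChart (α : ∀ x : M, TangentSpace I x →L[ℝ] ℝ) (x₀ : M) (y : V) : V →L[ℝ] ℝ :=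
  (α ((extChartAt I x₀).symm y)).comp (mfderiv 𝓘(ℝ, V) I (extChartAt I x₀).symm y)

/-- The exterior derivative of the one-form `α` on the boundaryless manifold `M`, at the point `x`:
`(dα)(X, Y) = D_X α̂ (Y) - D_Y α̂ (X)`, with `α̂` the coordinate expression of `α` in the preferred
chart around `x`. The components of tangent vectors at `x` in that chart are obtained by applying
the derivative of the chart. -/
def extDerivOneForm (α : ∀ x : M, TangentSpace I x →L[ℝ] ℝ) (x : M) :
    TangentSpace I x →L[ℝ] TangentSpace I x →L[ℝ] ℝ :=
  let D : V →L[ℝ] V →L[ℝ] ℝ := fderiv ℝ (oneFormInChart I α x) (extChartAt I x x)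
  let dχ : TangentSpace I x →L[ℝ] V := mfderiv I 𝓘(ℝ, V) (extChartAt I x) x
  (dχ.precomp ℝ).comp ((D - D.flip).comp dχ)

end ExteriorDerivative

section Cotangent

variable (E : Type*) [NormedAddCommGroup E] [NormedSpace ℝ E]
  (Q : Type*) [TopologicalSpace Q] [ChartedSpace E Q] [IsManifold 𝓘(ℝ, E) ∞ Q]

/-- The cotangent bundle `T^*Q`, with Mathlib's topology and manifold structure on the bundle of
continuous linear maps from `TQ` to the trivial line bundle. -/
abbrev CotangentBundle : Type _ :=
  TotalSpace (E →L[ℝ] ℝ) (fun q : Q => TangentSpace 𝓘(ℝ, E) q →L[ℝ] Bundle.Trivial Q ℝ q)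

/-- The model with corners of `T^*Q`. -/
abbrev cotangentModel : ModelWithCorners ℝ (E × (E →L[ℝ] ℝ)) (ModelProd E (E →L[ℝ] ℝ)) :=
  𝓘(ℝ, E).prod 𝓘(ℝ, E →L[ℝ] ℝ)

variable {E Q}

/-- The fundamental one-form of `T^*Q`: `ϑ₀(X) = ⟨p, dπ X⟩` for `X` tangent to `T^*Q` at `p`. -/
def fundamentalOneForm (p : CotangentBundle E Q) : TangentSpace (cotangentModel E) p →L[ℝ] ℝ :=
  ContinuousLinearMap.comp (p.2 : TangentSpace 𝓘(ℝ, E) p.1 →L[ℝ] ℝ)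
    (mfderiv (cotangentModel E) 𝓘(ℝ, E) (fun r : CotangentBundle E Q => r.1) p)

/-- The symplectic form `ω = dϑ₀` of `T^*Q`. -/
def symplecticForm (p : CotangentBundle E Q) :
    TangentSpace (cotangentModel E) p →L[ℝ] TangentSpace (cotangentModel E) p →L[ℝ] ℝ :=
  extDerivOneForm (cotangentModel E) fundamentalOneForm p

/-- The Hamiltonian vector field `X_f` of `f`: the solution of `ω(X_f, ·) = - df`. -/
def hamiltonianVectorField (f : CotangentBundle E Q → ℝ) (p : CotangentBundle E Q) :
    TangentSpace (cotangentModel E) p :=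
  (symplecticForm p).inverse (-mfderiv (cotangentModel E) 𝓘(ℝ, ℝ) f p)

/-- The Poisson bracket `{f₁, f₂} = - X_{f₁} f₂`. -/
def poissonBracket (f₁ f₂ : CotangentBundle E Q → ℝ) (p : CotangentBundle E Q) : ℝ :=
  -(mfderiv (cotangentModel E) 𝓘(ℝ, ℝ) f₂ p (hamiltonianVectorField f₁ p))

end Cotangent

section Lagrangian

variable {E : Type*} [NormedAddCommGroup E] [NormedSpace ℝ E]
  {Q : Type*} [TopologicalSpace Q] [ChartedSpace E Q] [IsManifold 𝓘(ℝ, E) ∞ Q]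

/-- The Legendre transformation `TQ → T^*Q` of the Lagrangian `l`, that is its fibre derivative. -/
def legendre (l : TangentBundle 𝓘(ℝ, E) Q → ℝ) (v : TangentBundle 𝓘(ℝ, E) Q) :
    CotangentBundle E Q :=
  ⟨v.1, fderiv ℝ (fun w : TangentSpace 𝓘(ℝ, E) v.1 => l ⟨v.1, w⟩) v.2⟩

/-- The first jet extension `t ↦ γ̇(t)` of a curve `γ` in `Q`. -/
def jetExtension (γ : ℝ → Q) (t : ℝ) : TangentBundle 𝓘(ℝ, E) Q :=
  ⟨γ t, mfderiv 𝓘(ℝ, ℝ) 𝓘(ℝ, E) γ t (1 : ℝ)⟩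

/-- The Lagrangian `l` as a function of positions and velocities in the chart `e`. -/
def localLagrangian (l : TangentBundle 𝓘(ℝ, E) Q → ℝ) (e : OpenPartialHomeomorph Q E)
    (x v : E) : ℝ :=
  l ⟨e.symm x, mfderiv 𝓘(ℝ, E) 𝓘(ℝ, E) e.symm x v⟩

/-- The curve `γ` satisfies at time `t` the Euler-Lagrange equations
`d/dt (∂l/∂ẋ) = ∂l/∂x` in every smooth chart of `Q` around `γ t`. -/
def EulerLagrangeAt (l : TangentBundle 𝓘(ℝ, E) Q → ℝ) (γ : ℝ → Q) (t : ℝ) : Prop :=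
  ∀ e ∈ IsManifold.maximalAtlas 𝓘(ℝ, E) ∞ Q, γ t ∈ e.source →
    HasDerivAt
      (fun s => fderiv ℝ (fun v => localLagrangian l e (e (γ s)) v) (deriv (fun r => e (γ r)) s))
      (fderiv ℝ (fun x => localLagrangian l e x (deriv (fun r => e (γ r)) t)) (e (γ t))) t

/-- The initial data constraint `𝓓 ⊆ TQ`: the velocities at time `0` of smooth solutions of the
Euler-Lagrange equations on some interval around `0`. -/
def initialDataConstraint (l : TangentBundle 𝓘(ℝ, E) Q → ℝ) : Set (TangentBundle 𝓘(ℝ, E) Q) :=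
  {v | ∃ ε > 0, ∃ γ : ℝ → Q, ContMDiffOn 𝓘(ℝ, ℝ) 𝓘(ℝ, E) ∞ γ (Ioo (-ε) ε) ∧
    (∀ t ∈ Ioo (-ε) ε, EulerLagrangeAt l γ t) ∧ jetExtension γ 0 = v}

/-- The constraint set `𝓒 ⊆ T^*Q`, the image of the initial data constraint under the Legendre
transformation. -/
def constraintSet (l : TangentBundle 𝓘(ℝ, E) Q → ℝ) : Set (CotangentBundle E Q) :=
  legendre l '' initialDataConstraint l

/-- Constraint functions: smooth functions on `T^*Q` that vanish on the constraint set. -/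
def IsConstraintFunction (l : TangentBundle 𝓘(ℝ, E) Q → ℝ) (c : CotangentBundle E Q → ℝ) : Prop :=
  ContMDiff (cotangentModel E) 𝓘(ℝ, ℝ) ∞ c ∧ ∀ p ∈ constraintSet l, c p = 0

/-- First class functions: smooth functions on `T^*Q` whose Poisson bracket with every constraint
function is a constraint function. -/
def IsFirstClass (l : TangentBundle 𝓘(ℝ, E) Q → ℝ) (f : CotangentBundle E Q → ℝ) : Prop :=
  ContMDiff (cotangentModel E) 𝓘(ℝ, ℝ) ∞ f ∧
    ∀ c, IsConstraintFunction l c → IsConstraintFunction l (poissonBracket f c)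

end Lagrangian

section Action

variable {E : Type*} [NormedAddCommGroup E] [NormedSpace ℝ E]
  {Q : Type*} [TopologicalSpace Q] [ChartedSpace E Q] [IsManifold 𝓘(ℝ, E) ∞ Q]
  {F : Type*} [NormedAddCommGroup F] [NormedSpace ℝ F]
  {G : Type*} [TopologicalSpace G] [ChartedSpace F G] [Group G] [MulAction G Q]

/-- The lift of the action to `TQ`: `g` acts by the derivative of `q ↦ g • q`. -/
def tangentLift (g : G) (v : TangentBundle 𝓘(ℝ, E) Q) : TangentBundle 𝓘(ℝ, E) Q :=
  tangentMap 𝓘(ℝ, E) 𝓘(ℝ, E) (fun q : Q => g • q) v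

/-- The lift of the action to `T^*Q`: `⟨g • p, v⟩ = ⟨p, g⁻¹ • v⟩` for `p ∈ T^*_q Q` and
`v ∈ T_{g • q} Q`. The derivative of `g⁻¹` lands in the tangent space at `g⁻¹ • g • q = q`. -/
def cotangentLift (g : G) (p : CotangentBundle E Q) : CotangentBundle E Q :=
  ⟨g • p.1, ContinuousLinearMap.comp (p.2 : TangentSpace 𝓘(ℝ, E) p.1 →L[ℝ] ℝ)
    (mfderiv 𝓘(ℝ, E) 𝓘(ℝ, E) (fun q : Q => g⁻¹ • q) (g • p.1))⟩

/-- The value at `p` of the vector field on `T^*Q` that generates the action of the one-parameter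
subgroup with velocity `ξ ∈ 𝔤`: the derivative of `g ↦ g • p` at `1` applied to `ξ`. -/
def cotangentGenerator (ξ : GroupLieAlgebra 𝓘(ℝ, F) G) (p : CotangentBundle E Q) :
    TangentSpace (cotangentModel E) p :=
  mfderiv 𝓘(ℝ, F) (cotangentModel E) (fun g : G => cotangentLift g p) 1 ξ

/-- The component `j_ξ` of the momentum map of the lifted action on `T^*Q`: the fundamental one-form
evaluated on the generator of the action of `ξ`. -/
def momentum (ξ : GroupLieAlgebra 𝓘(ℝ, F) G) (p : CotangentBundle E Q) : ℝ :=
  fundamentalOneForm p (cotangentGenerator ξ p)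

variable (G) in
/-- `G` is a symmetry group of the Lagrangian `l`: the lifted action on `TQ` leaves `l`
invariant. -/
def IsSymmetryGroup (l : TangentBundle 𝓘(ℝ, E) Q → ℝ) : Prop :=
  ∀ (g : G) (v : TangentBundle 𝓘(ℝ, E) Q), l (tangentLift g v) = l v

end Action

end

/-! In bundle coordinates `(x, η)` the fundamental one-form is `η dx`, so `ω(X, Y) = X.2 Y.1 - Y.2
X.1`. This form is nondegenerate in finite dimension, and `X_f` is characterized by `ω(X_f, ·) =
-df`. The projection to `Q` intertwines the two actions, so `j_ξ(p) = ⟨p, ξ_Q⟩`. The lifted action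
preserves the pairing of covectors with vectors. Differentiating this invariance at the identity and
exchanging mixed second derivatives gives Hamilton's equations for the generator
(`hamilton_equations_of_family`), which is claim 1.

Invariance of `l` makes the Legendre transformation equivariant (`legendre_tangentLift`) and carries
Euler–Lagrange solutions to solutions (`EulerLagrangeAt.smul`). Hence `𝓓` and `𝓒` are invariant
under the group.

By claim 1, `{j_ξ, c}(p)` is minus the derivative of `g ↦ c (g • p)` at `1` along `ξ`. For `p ∈ 𝓒`
that function of `g` vanishes identically, so `j_ξ` is first class. Also by claim 1, uniqueness of
integral curves places each integral curve of `X_{j_ξ}` locally inside one group orbit. Membership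
in `𝓒` is then locally constant along the curve, hence constant on an interval. -/

set_option linter.unusedSectionVars false

/-! ### Bundle coordinates on `T^*Q` and the canonical symplectic form -/

section CotangentChart

variable {E : Type*} [NormedAddCommGroup E] [NormedSpace ℝ E]
  {Q : Type*} [TopologicalSpace Q] [ChartedSpace E Q] [IsManifold 𝓘(ℝ, E) ∞ Q]

/-- The covector `η ∈ T^*_q Q` in the coordinates of the preferred chart around `q₀`. -/
noncomputable def covectorInChart (q₀ q : Q) (η : TangentSpace 𝓘(ℝ, E) q →L[ℝ] ℝ) : E →L[ℝ] ℝ :=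
  ContinuousLinearMap.comp η
    (mfderiv 𝓘(ℝ, E) 𝓘(ℝ, E) (extChartAt 𝓘(ℝ, E) q₀).symm (extChartAt 𝓘(ℝ, E) q₀ q))

/-- Trivializing `TQ` in the source contributes the derivative of the inverse chart; the trivial
line bundle in the target contributes nothing. -/
theorem inCoordinates_cotangent {q₀ q : Q} (hq : q ∈ (chartAt E q₀).source)
    (η : TangentSpace 𝓘(ℝ, E) q →L[ℝ] Bundle.Trivial Q ℝ q) :
    ContinuousLinearMap.inCoordinates E (TangentSpace 𝓘(ℝ, E)) ℝ (Bundle.Trivial Q ℝ) q₀ q q₀ q η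
      = covectorInChart (E := E) q₀ q η := by
  rw [ContinuousLinearMap.inCoordinates, TangentBundle.symmL_trivializationAt hq]
  simp only [modelWithCornersSelf_coe, range_id, mfderivWithin_univ]
  erw [Bundle.Trivial.continuousLinearMapAt_trivialization]
  rfl

theorem extChartAt_cotangent_fst (p r : CotangentBundle E Q) :
    (extChartAt (cotangentModel E) p r).1 = extChartAt 𝓘(ℝ, E) p.1 r.1 := by
  rfl

theorem extChartAt_cotangent_snd {p r : CotangentBundle E Q} (hr : r.1 ∈ (chartAt E p.1).source) :
    (extChartAt (cotangentModel E) p r).2 = covectorInChart (E := E) p.1 r.1 r.2 := by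
  rw [← inCoordinates_cotangent hr]
  rfl

theorem mem_extChartAt_cotangent_source {p r : CotangentBundle E Q} :
    r ∈ (extChartAt (cotangentModel E) p).source ↔ r.1 ∈ (chartAt E p.1).source := by
  rw [FiberBundle.extChartAt]
  simp only [PartialEquiv.trans_source, PartialEquiv.prod_source, mem_inter_iff, mem_preimage,
    extChartAt_source]
  simp only [hom_trivializationAt_source]
  exact ⟨fun h => h.2.1, fun h => ⟨⟨h, mem_univ _⟩, h, mem_univ _⟩⟩

theorem extChartAt_cotangent_symm_fst {p : CotangentBundle E Q} {y : E × (E →L[ℝ] ℝ)}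
    (hy : y ∈ (extChartAt (cotangentModel E) p).target) :
    ((extChartAt (cotangentModel E) p).symm y).1 = (extChartAt 𝓘(ℝ, E) p.1).symm y.1 := by
  have h1 := (extChartAt (cotangentModel E) p).map_target hy
  have h2 := (extChartAt (cotangentModel E) p).right_inv hy
  rw [mem_extChartAt_cotangent_source] at h1
  have h3 := congrArg Prod.fst h2
  rw [extChartAt_cotangent_fst] at h3
  rw [← h3, (extChartAt 𝓘(ℝ, E) p.1).left_inv (by simpa using h1)]

/-- The fundamental one-form is `y ↦ y.2 ∘ fst` in bundle coordinates. -/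
theorem oneFormInChart_fundamentalOneForm {p : CotangentBundle E Q} {y : E × (E →L[ℝ] ℝ)}
    (hy : y ∈ (extChartAt (cotangentModel E) p).target) :
    oneFormInChart (cotangentModel E) fundamentalOneForm p y =
      y.2.comp (ContinuousLinearMap.fst ℝ E (E →L[ℝ] ℝ)) := by
  have h1 := (extChartAt (cotangentModel E) p).map_target hy
  have h2 := (extChartAt (cotangentModel E) p).right_inv hy
  rw [mem_extChartAt_cotangent_source] at h1
  have h3 : y.2 = _ := (congrArg Prod.snd h2).symm.trans (extChartAt_cotangent_snd h1)
  have h4 : extChartAt 𝓘(ℝ, E) p.1 ((extChartAt (cotangentModel E) p).symm y).1 = y.1 :=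
    congrArg Prod.fst h2
  have hd : MDifferentiableAt 𝓘(ℝ, E × (E →L[ℝ] ℝ)) (cotangentModel E)
      (extChartAt (cotangentModel E) p).symm y := by
    exact (mdifferentiableWithinAt_extChartAt_symm hy).mdifferentiableAt
      (by rw [(cotangentModel E).range_eq_univ]; exact Filter.univ_mem)
  have hd' : MDifferentiableAt 𝓘(ℝ, E) 𝓘(ℝ, E) (extChartAt 𝓘(ℝ, E) p.1).symm y.1 := by
    refine (mdifferentiableWithinAt_extChartAt_symm ?_).mdifferentiableAt
      (by rw [ModelWithCorners.range_eq_univ]; exact Filter.univ_mem)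
    rw [← h4]
    exact (extChartAt 𝓘(ℝ, E) p.1).map_source (by simpa using h1)
  have hπ : MDifferentiableAt (cotangentModel E) 𝓘(ℝ, E) (fun r : CotangentBundle E Q => r.1)
      ((extChartAt (cotangentModel E) p).symm y) :=
    (contMDiff_proj _ (n := 1)).mdifferentiableAt one_ne_zero
  -- In coordinates the bundle projection is `fst`. Differentiating this identity makes `dπ` factor
  -- through the derivative of the inverse chart of `Q`, and the covector composed with that
  -- derivative is `y.2`.
  have key : mfderiv 𝓘(ℝ, E × (E →L[ℝ] ℝ)) 𝓘(ℝ, E)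
      (fun z => ((extChartAt (cotangentModel E) p).symm z).1) y =
      mfderiv 𝓘(ℝ, E × (E →L[ℝ] ℝ)) 𝓘(ℝ, E)
        (fun z : E × (E →L[ℝ] ℝ) => (extChartAt 𝓘(ℝ, E) p.1).symm z.1) y := by
    apply Filter.EventuallyEq.mfderiv_eq
    filter_upwards [(isOpen_extChartAt_target (I := cotangentModel E) p).mem_nhds hy] with z hz
    exact extChartAt_cotangent_symm_fst hz
  have e1 := mfderiv_comp y hπ hd
  have e2 := mfderiv_comp (I := 𝓘(ℝ, E × (E →L[ℝ] ℝ))) y hd'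
    (f := fun z : E × (E →L[ℝ] ℝ) => z.1) differentiableAt_fst.mdifferentiableAt
  refine ContinuousLinearMap.ext fun Y => ?_
  have e3 := congrArg (fun A : (E × (E →L[ℝ] ℝ)) →L[ℝ] E => A Y) (e1.symm.trans (key.trans e2))
  rw [h3, covectorInChart, h4]
  have e4 : mfderiv 𝓘(ℝ, E × (E →L[ℝ] ℝ)) 𝓘(ℝ, E) (fun z : E × (E →L[ℝ] ℝ) => z.1) y =
    ContinuousLinearMap.fst ℝ E (E →L[ℝ] ℝ) := by
    rw [mfderiv_eq_fderiv, fderiv_fst]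
  rw [e4] at e3
  exact congrArg (fun w : E => ((extChartAt (cotangentModel E) p).symm y).2 w) e3

set_option synthInstance.maxHeartbeats 200000 in
/-- In the preferred chart at `p` the symplectic form at `p` is the canonical one. -/
theorem symplecticForm_apply (p : CotangentBundle E Q)
    (X Y : E × (E →L[ℝ] ℝ)) :
    (symplecticForm p : (E × (E →L[ℝ] ℝ)) →L[ℝ] (E × (E →L[ℝ] ℝ)) →L[ℝ] ℝ) X Y =
      X.2 Y.1 - Y.2 X.1 := by
  have hD : fderiv ℝ (oneFormInChart (cotangentModel E) fundamentalOneForm p)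
      (extChartAt (cotangentModel E) p p) =
      (ContinuousLinearMap.precomp ℝ (ContinuousLinearMap.fst ℝ E (E →L[ℝ] ℝ))).comp
          (ContinuousLinearMap.snd ℝ E (E →L[ℝ] ℝ)) := by
    refine HasFDerivAt.fderiv (HasFDerivAt.congr_of_eventuallyEq
      (ContinuousLinearMap.hasFDerivAt _) ?_)
    filter_upwards [extChartAt_target_mem_nhds (I := cotangentModel E) p] with y hy
    rw [oneFormInChart_fundamentalOneForm hy]
    rfl
  -- Tangent vectors at `p` are by convention already read in the preferred chart at `p`, so the
  -- derivative of that chart at its centre is the identity.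
  have hχ : ∀ Z : E × (E →L[ℝ] ℝ), (mfderiv (cotangentModel E) 𝓘(ℝ, E × (E →L[ℝ] ℝ))
      (extChartAt (cotangentModel E) p) p : (E × (E →L[ℝ] ℝ)) →L[ℝ] (E × (E →L[ℝ] ℝ))) Z = Z := by
    intro Z
    rw [mfderiv_extChartAt_self]
    rfl
  have h0 : (symplecticForm p : (E × (E →L[ℝ] ℝ)) →L[ℝ] (E × (E →L[ℝ] ℝ)) →L[ℝ] ℝ) X Y =
      fderiv ℝ (oneFormInChart (cotangentModel E) fundamentalOneForm p)
        (extChartAt (cotangentModel E) p p) ((mfderiv (cotangentModel E) 𝓘(ℝ, E × (E →L[ℝ] ℝ))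
      (extChartAt (cotangentModel E) p) p : (E × (E →L[ℝ] ℝ)) →L[ℝ] (E × (E →L[ℝ] ℝ))) X)
      ((mfderiv (cotangentModel E) 𝓘(ℝ, E × (E →L[ℝ] ℝ))
      (extChartAt (cotangentModel E) p) p : (E × (E →L[ℝ] ℝ)) →L[ℝ] (E × (E →L[ℝ] ℝ))) Y) -
      fderiv ℝ (oneFormInChart (cotangentModel E) fundamentalOneForm p)
        (extChartAt (cotangentModel E) p p) ((mfderiv (cotangentModel E) 𝓘(ℝ, E × (E →L[ℝ] ℝ))
      (extChartAt (cotangentModel E) p) p : (E × (E →L[ℝ] ℝ)) →L[ℝ] (E × (E →L[ℝ] ℝ))) Y)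
      ((mfderiv (cotangentModel E) 𝓘(ℝ, E × (E →L[ℝ] ℝ))
      (extChartAt (cotangentModel E) p) p : (E × (E →L[ℝ] ℝ)) →L[ℝ] (E × (E →L[ℝ] ℝ))) X) := rfl
  rw [h0, hχ, hχ, hD]
  rfl

/-- `ContinuousLinearMap.inverse` is zero on maps that are not invertible. Here injectivity and
equality of dimensions of `V` and its dual make `B` invertible, so the default value does not occur.
-/
theorem inverse_apply_of_nondegenerate {V : Type*} [NormedAddCommGroup V] [NormedSpace ℝ V]
    [FiniteDimensional ℝ V] (B : V →L[ℝ] V →L[ℝ] ℝ) (hB : ∀ X, (∀ Y, B X Y = 0) → X = 0) (X : V) :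
    B.inverse (B X) = X := by
  have hinj : Function.Injective B.toLinearMap := by
    rw [← LinearMap.ker_eq_bot, LinearMap.ker_eq_bot']
    exact fun X h => hB X fun Y => DFunLike.congr_fun h Y
  have hrank : Module.finrank ℝ V = Module.finrank ℝ (V →L[ℝ] ℝ) := by
    rw [← (LinearMap.toContinuousLinearMap (𝕜 := ℝ) (E := V) (F' := ℝ)).finrank_eq]
    exact (Subspace.dual_finrank_eq).symm
  let e₀ : V ≃ₗ[ℝ] (V →L[ℝ] ℝ) := LinearEquiv.ofInjectiveOfFinrankEq B.toLinearMap hinj hrank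
  let e : V ≃L[ℝ] (V →L[ℝ] ℝ) := e₀.toContinuousLinearEquiv
  have he : B = e := by ext : 1; rfl
  rw [he, ContinuousLinearMap.inverse_equiv]
  exact e.symm_apply_apply X

/-- The Hamiltonian vector field is characterized by `ω(X, ·) = - df`. -/
theorem hamiltonianVectorField_eq [FiniteDimensional ℝ E] {f : CotangentBundle E Q → ℝ}
    {p : CotangentBundle E Q} {X : E × (E →L[ℝ] ℝ)}
    (h : ∀ Y : E × (E →L[ℝ] ℝ), X.2 Y.1 - Y.2 X.1 =
      -((mfderiv (cotangentModel E) 𝓘(ℝ, ℝ) f p : (E × (E →L[ℝ] ℝ)) →L[ℝ] ℝ) Y)) :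
    hamiltonianVectorField f p = X := by
  let B : (E × (E →L[ℝ] ℝ)) →L[ℝ] (E × (E →L[ℝ] ℝ)) →L[ℝ] ℝ := symplecticForm p
  have h1 : B X = -(mfderiv (cotangentModel E) 𝓘(ℝ, ℝ) f p : (E × (E →L[ℝ] ℝ)) →L[ℝ] ℝ) :=
    ContinuousLinearMap.ext fun Y => (symplecticForm_apply p X Y).trans (h Y)
  have h2 : hamiltonianVectorField f p =
    B.inverse (-(mfderiv (cotangentModel E) 𝓘(ℝ, ℝ) f p : (E × (E →L[ℝ] ℝ)) →L[ℝ] ℝ)) := rfl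
  rw [h2, ← h1]
  refine inverse_apply_of_nondegenerate B (fun ⟨x, η⟩ h => ?_) X
  have h' : ∀ Y : E × (E →L[ℝ] ℝ), η Y.1 - Y.2 x = 0 := fun Y =>
    (symplecticForm_apply p (x, η) Y).symm.trans (h Y)
  have hη : η = 0 := ContinuousLinearMap.ext fun y => by simpa using h' (y, 0)
  have hx : x = 0 := SeparatingDual.eq_zero_of_forall_dual_eq_zero (R := ℝ) fun f => by
    simpa using h' (0, f)
  rw [hη, hx]; rfl

end CotangentChart

/-! ### The lifted actions and equivariance of the Legendre transformation -/

section CotangentLift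

variable {E : Type*} [NormedAddCommGroup E] [NormedSpace ℝ E]
  {Q : Type*} [TopologicalSpace Q] [ChartedSpace E Q] [IsManifold 𝓘(ℝ, E) ∞ Q]
  {F : Type*} [NormedAddCommGroup F] [NormedSpace ℝ F]
  {G : Type*} [TopologicalSpace G] [ChartedSpace F G] [Group G] [MulAction G Q]

/-- In trivializations the lift is the composition of the coordinate covector with the coordinate
derivative of `g⁻¹`, and both depend smoothly on `(g, p)`. -/
theorem contMDiff_cotangentLift [LieGroup 𝓘(ℝ, F) ∞ G] [ContMDiffSMul 𝓘(ℝ, F) 𝓘(ℝ, E) ∞ G Q] :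
    ContMDiff (𝓘(ℝ, F).prod (cotangentModel E)) (cotangentModel E) ∞
      (fun x : G × CotangentBundle E Q => cotangentLift x.1 x.2) := by
  intro x₀
  have hq : ContMDiff (𝓘(ℝ, F).prod (cotangentModel E)) 𝓘(ℝ, E) ∞
      (fun x : G × CotangentBundle E Q => x.2.1) :=
    (contMDiff_proj _).comp contMDiff_snd
  have hb : ContMDiff (𝓘(ℝ, F).prod (cotangentModel E)) 𝓘(ℝ, E) ∞
      (fun x : G × CotangentBundle E Q => x.1 • x.2.1) :=
    (ContMDiffSMul.contMDiff_smul (I := 𝓘(ℝ, F))).comp (contMDiff_fst.prodMk hq)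
  rw [contMDiffAt_hom_bundle]
  refine ⟨hb x₀, ?_⟩
  have h1 : ContMDiffAt (𝓘(ℝ, F).prod (cotangentModel E)) 𝓘(ℝ, E →L[ℝ] ℝ) ∞
      (fun x : G × CotangentBundle E Q => ContinuousLinearMap.inCoordinates E (TangentSpace 𝓘(ℝ, E)) ℝ
        (Bundle.Trivial Q ℝ) x₀.2.1 x.2.1 x₀.2.1 x.2.1 x.2.2) x₀ :=
    ((contMDiffAt_hom_bundle (fun x : G × CotangentBundle E Q => x.2)).1
      contMDiff_snd.contMDiffAt).2
  have h2 := ContMDiffAt.mfderiv (I := 𝓘(ℝ, E)) (I' := 𝓘(ℝ, E)) (n := ∞) (m := ∞) (x₀ := x₀)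
    (fun (x : G × CotangentBundle E Q) (q : Q) => x.1⁻¹ • q) (fun x => x.1 • x.2.1)
    (((ContMDiffSMul.contMDiff_smul (I := 𝓘(ℝ, F))).comp
      (((contMDiff_inv 𝓘(ℝ, F) ∞).comp (contMDiff_fst.comp contMDiff_fst)).prodMk
        contMDiff_snd)).contMDiffAt) (hb x₀) (by simp)
  simp only [inv_smul_smul] at h2
  refine (h1.clm_comp h2).congr_of_eventuallyEq ?_
  -- Near `x₀` the base point stays in the trivialization domain, where the two intermediate
  -- trivializations of `TQ` cancel.
  have h3 := hq.continuous.continuousAt.preimage_mem_nhds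
    ((trivializationAt E (TangentSpace 𝓘(ℝ, E)) x₀.2.1).open_baseSet.mem_nhds
      (FiberBundle.mem_baseSet_trivializationAt' x₀.2.1))
  filter_upwards [h3] with x hx
  ext v
  simp only [ContinuousLinearMap.inCoordinates, inTangentCoordinates,
    ContinuousLinearMap.comp_apply]
  erw [Trivialization.symmL_continuousLinearMapAt _ hx]
  rfl

theorem CotangentBundle.ext_of_eq {q q' : Q} {η η' : E →L[ℝ] ℝ} (hq : q = q') (hη : η = η') :
    (⟨q, η⟩ : CotangentBundle E Q) = ⟨q', η'⟩ := by
  subst hq hη; rfl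

theorem TangentBundle.ext_of_eq {q q' : Q} {v v' : E} (hq : q = q') (hv : v = v') :
    (⟨q, v⟩ : TangentBundle 𝓘(ℝ, E) Q) = ⟨q', v'⟩ := by
  subst hq hv; rfl

/-- The derivative of the action of `g` at `q`, as a linear map between model spaces. -/
noncomputable def smulDeriv (g : G) (q : Q) : E →L[ℝ] E :=
  mfderiv 𝓘(ℝ, E) 𝓘(ℝ, E) (fun q : Q => g • q) q

theorem mdifferentiable_const_smul [ContMDiffSMul 𝓘(ℝ, F) 𝓘(ℝ, E) ∞ G Q] (g : G) :
    MDifferentiable 𝓘(ℝ, E) 𝓘(ℝ, E) (fun q : Q => g • q) :=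
  (ContMDiffSMul.contMDiff_const_smul (I := 𝓘(ℝ, F)) (n := ∞) g).mdifferentiable (by simp)

theorem smulDeriv_mul [ContMDiffSMul 𝓘(ℝ, F) 𝓘(ℝ, E) ∞ G Q] (g h : G) (q : Q) :
    smulDeriv (E := E) (g * h) q = (smulDeriv g (h • q)).comp (smulDeriv h q) := by
  have h1 := mfderiv_comp q (mdifferentiable_const_smul (E := E) (F := F) g (h • q))
    (mdifferentiable_const_smul (E := E) (F := F) h q)
  have h2 : (fun q : Q => (g * h) • q) = (fun q : Q => g • q) ∘ (fun q : Q => h • q) :=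
    funext fun q => mul_smul g h q
  unfold smulDeriv
  rw [h2]
  exact h1

theorem smulDeriv_one (q : Q) : smulDeriv (E := E) (1 : G) q = ContinuousLinearMap.id ℝ E := by
  have h2 : (fun q : Q => (1 : G) • q) = id := funext fun q => one_smul G q
  unfold smulDeriv
  rw [h2]
  exact mfderiv_id

/-- The derivative of the action of `g` at `q`, as an isomorphism of model spaces. -/
noncomputable def smulDerivEquiv [ContMDiffSMul 𝓘(ℝ, F) 𝓘(ℝ, E) ∞ G Q] (g : G) (q : Q) : E ≃L[ℝ] E :=
  ContinuousLinearEquiv.equivOfInverse (smulDeriv g q) (smulDeriv g⁻¹ (g • q))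
    (fun v => by
      have := smulDeriv_mul (E := E) (F := F) g⁻¹ g q
      rw [inv_mul_cancel, smulDeriv_one] at this
      exact (DFunLike.congr_fun this v).symm)
    (fun v => by
      have := smulDeriv_mul (E := E) (F := F) g g⁻¹ (g • q)
      rw [mul_inv_cancel, smulDeriv_one, inv_smul_smul] at this
      exact (DFunLike.congr_fun this v).symm)

theorem cotangentLift_mul [ContMDiffSMul 𝓘(ℝ, F) 𝓘(ℝ, E) ∞ G Q] (g h : G)
    (p : CotangentBundle E Q) :
    cotangentLift (g * h) p = cotangentLift g (cotangentLift h p) := by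
  refine CotangentBundle.ext_of_eq (E := E) (mul_smul g h p.1) ?_
  have h1 := smulDeriv_mul (E := E) (F := F) h⁻¹ g⁻¹ ((g * h) • p.1)
  rw [← mul_inv_rev, mul_smul, inv_smul_smul] at h1
  have h2 : (ContinuousLinearMap.comp (p.2 : TangentSpace 𝓘(ℝ, E) p.1 →L[ℝ] ℝ)
        (smulDeriv (E := E) (g * h)⁻¹ ((g * h) • p.1)) : E →L[ℝ] ℝ) =
      (ContinuousLinearMap.comp (p.2 : TangentSpace 𝓘(ℝ, E) p.1 →L[ℝ] ℝ)
        ((smulDeriv (E := E) h⁻¹ (h • p.1)).comp (smulDeriv (E := E) g⁻¹ (g • h • p.1)))) := by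
    rw [← h1, mul_smul]
  exact h2

theorem cotangentLift_one (p : CotangentBundle E Q) : cotangentLift (1 : G) p = p := by
  refine CotangentBundle.ext_of_eq (E := E) (one_smul G p.1) ?_
  have h1 : smulDeriv (E := E) (1 : G)⁻¹ ((1 : G) • p.1) = ContinuousLinearMap.id ℝ E := by
    rw [inv_one, smulDeriv_one]
  exact congrArg (fun A : E →L[ℝ] E =>
    (ContinuousLinearMap.comp (p.2 : TangentSpace 𝓘(ℝ, E) p.1 →L[ℝ] ℝ) A : E →L[ℝ] ℝ)) h1

theorem IsSymmetryGroup.apply_mk {l : TangentBundle 𝓘(ℝ, E) Q → ℝ} (hG : IsSymmetryGroup G l) (g : G)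
    (q : Q) (v : E) : l ⟨g • q, smulDeriv (E := E) g q v⟩ = l ⟨q, v⟩ :=
  hG g ⟨q, v⟩

/-- On the fibre over `g • q`, `l` is its restriction to the fibre over `q` precomposed with the
inverse of the linear isomorphism `Dg`; the chain rule turns this into the dual action. -/
theorem legendre_tangentLift [ContMDiffSMul 𝓘(ℝ, F) 𝓘(ℝ, E) ∞ G Q]
    {l : TangentBundle 𝓘(ℝ, E) Q → ℝ} (hG : IsSymmetryGroup G l) (g : G)
    (v : TangentBundle 𝓘(ℝ, E) Q) :
    legendre l (tangentLift g v) = cotangentLift g (legendre l v) := by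
  refine CotangentBundle.ext_of_eq (E := E) rfl ?_
  let A := smulDerivEquiv (E := E) (F := F) g v.1
  have h1 : (fun w : E => l ⟨g • v.1, w⟩) = (fun w : E => l ⟨v.1, w⟩) ∘ A.symm := by
    funext w
    have := hG.apply_mk g v.1 (A.symm w)
    rw [← Function.comp_apply (f := fun w : E => l ⟨v.1, w⟩)] at this
    rw [← this]
    exact congrArg (fun w : E => l ⟨g • v.1, w⟩) (A.apply_symm_apply w).symm
  have h2 := A.symm.comp_right_fderiv (f := fun w : E => l ⟨v.1, w⟩) (x := A v.2)
  rw [← h1] at h2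
  exact h2.trans (congrArg (fun z : E => (fderiv ℝ (fun w : E => l ⟨v.1, w⟩) z).comp
    (A.symm : E →L[ℝ] E)) (A.symm_apply_apply v.2))

end CotangentLift

/-! ### Symmetries act on Euler–Lagrange solutions and on the constraint set -/

section SymmetricSolutions

variable {E : Type*} [NormedAddCommGroup E] [NormedSpace ℝ E]
  {Q : Type*} [TopologicalSpace Q] [ChartedSpace E Q] [IsManifold 𝓘(ℝ, E) ∞ Q]
  {F : Type*} [NormedAddCommGroup F] [NormedSpace ℝ F]
  {G : Type*} [TopologicalSpace G] [ChartedSpace F G] [Group G] [MulAction G Q]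

theorem jetExtension_smul [ContMDiffSMul 𝓘(ℝ, F) 𝓘(ℝ, E) ∞ G Q] (g : G) {γ : ℝ → Q} {t : ℝ}
    (hγ : MDifferentiableAt 𝓘(ℝ, ℝ) 𝓘(ℝ, E) γ t) :
    jetExtension (E := E) (fun s => g • γ s) t = tangentLift g (jetExtension γ t) := by
  refine TangentBundle.ext_of_eq (E := E) rfl ?_
  have h := mfderiv_comp t (mdifferentiable_const_smul (E := E) (F := F) g (γ t)) hγ
  exact congrArg (fun A : ℝ →L[ℝ] E => A 1) h

variable (E F) in
/-- The chart `q ↦ e (g • q)`. -/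
noncomputable def smulChart [ContMDiffSMul 𝓘(ℝ, F) 𝓘(ℝ, E) ∞ G Q] (g : G)
    (e : OpenPartialHomeomorph Q E) : OpenPartialHomeomorph Q E :=
  (Diffeomorph.smul 𝓘(ℝ, F) 𝓘(ℝ, E) ∞ g : Q ≃ₘ^∞⟮𝓘(ℝ, E), 𝓘(ℝ, E)⟯ Q).toHomeomorph.transOpenPartialHomeomorph e

theorem smulChart_mem_maximalAtlas [ContMDiffSMul 𝓘(ℝ, F) 𝓘(ℝ, E) ∞ G Q] (g : G)
    {e : OpenPartialHomeomorph Q E} (he : e ∈ IsManifold.maximalAtlas 𝓘(ℝ, E) ∞ Q) :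
    smulChart E F g e ∈ IsManifold.maximalAtlas 𝓘(ℝ, E) ∞ Q := by
  apply OpenPartialHomeomorph.mem_maximalAtlas_of_contMDiffOn
  · exact (contMDiffOn_of_mem_maximalAtlas he).comp
      (ContMDiffSMul.contMDiff_const_smul (I := 𝓘(ℝ, F)) g).contMDiffOn fun q hq => hq
  · exact (ContMDiffSMul.contMDiff_const_smul (I := 𝓘(ℝ, F)) g⁻¹).comp_contMDiffOn
      (contMDiffOn_symm_of_mem_maximalAtlas he)

/-- The inverse of the translated chart is `g⁻¹ ∘ e.symm`, so the two sides evaluate `l` at vectors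
related by the lift of `g⁻¹`. -/
theorem localLagrangian_smulChart [ContMDiffSMul 𝓘(ℝ, F) 𝓘(ℝ, E) ∞ G Q]
    {l : TangentBundle 𝓘(ℝ, E) Q → ℝ} (hG : IsSymmetryGroup G l) (g : G)
    {e : OpenPartialHomeomorph Q E} (he : e ∈ IsManifold.maximalAtlas 𝓘(ℝ, E) ∞ Q) {x : E}
    (hx : x ∈ e.target) (v : E) :
    localLagrangian l (smulChart E F g e) x v = localLagrangian l e x v := by
  have hd : MDifferentiableAt 𝓘(ℝ, E) 𝓘(ℝ, E) e.symm x :=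
    ((contMDiffOn_symm_of_mem_maximalAtlas he).contMDiffAt
      (e.open_target.mem_nhds hx)).mdifferentiableAt (by simp)
  have h := mfderiv_comp x (mdifferentiable_const_smul (E := E) (F := F) g⁻¹ (e.symm x)) hd
  have h1 : localLagrangian l (smulChart E F g e) x v = l ⟨g⁻¹ • e.symm x,
      smulDeriv (E := E) g⁻¹ (e.symm x) (mfderiv 𝓘(ℝ, E) 𝓘(ℝ, E) e.symm x v)⟩ :=
    congrArg (fun A : E →L[ℝ] E => l ⟨g⁻¹ • e.symm x, A v⟩) h
  rw [h1]
  exact hG.apply_mk g⁻¹ (e.symm x) (mfderiv 𝓘(ℝ, E) 𝓘(ℝ, E) e.symm x v)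

/-- The equations are required in every smooth chart. Those for `g • γ` in `e` are those for `γ` in
the chart `e ∘ g`: the coordinate curves coincide, and the local Lagrangians agree on `e.target`. -/
theorem EulerLagrangeAt.smul [ContMDiffSMul 𝓘(ℝ, F) 𝓘(ℝ, E) ∞ G Q]
    {l : TangentBundle 𝓘(ℝ, E) Q → ℝ} (hG : IsSymmetryGroup G l) (g : G) {γ : ℝ → Q} {t : ℝ}
    (hc : ContinuousAt γ t) (h : EulerLagrangeAt l γ t) :
    EulerLagrangeAt l (fun s => g • γ s) t := by
  intro e he ht
  have h1 := h (smulChart E F g e) (smulChart_mem_maximalAtlas g he) ht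
  have hγ : ContinuousAt (fun s => g • γ s) t :=
    (mdifferentiable_const_smul (E := E) (F := F) g).continuous.continuousAt.comp hc
  have e1 : ∀ s, smulChart E F g e (γ s) = e (g • γ s) := fun s => rfl
  simp only [e1] at h1
  have e2 : fderiv ℝ (fun x => localLagrangian l (smulChart E F g e) x
        (deriv (fun r => e (g • γ r)) t)) (e (g • γ t)) =
      fderiv ℝ (fun x => localLagrangian l e x (deriv (fun r => e (g • γ r)) t)) (e (g • γ t)) := by
    apply Filter.EventuallyEq.fderiv_eq
    filter_upwards [e.open_target.mem_nhds (e.map_source ht)] with x hx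
    exact localLagrangian_smulChart hG g he hx _
  rw [e2] at h1
  refine h1.congr_of_eventuallyEq ?_
  filter_upwards [hγ.preimage_mem_nhds (e.open_source.mem_nhds ht)] with s hs
  congr 1
  funext v
  exact (localLagrangian_smulChart hG g he (e.map_source hs) v).symm

theorem tangentLift_mem_initialDataConstraint [ContMDiffSMul 𝓘(ℝ, F) 𝓘(ℝ, E) ∞ G Q]
    {l : TangentBundle 𝓘(ℝ, E) Q → ℝ} (hG : IsSymmetryGroup G l) (g : G)
    {v : TangentBundle 𝓘(ℝ, E) Q} (hv : v ∈ initialDataConstraint l) :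
    tangentLift g v ∈ initialDataConstraint l := by
  obtain ⟨ε, hε, γ, hγ, hEL, rfl⟩ := hv
  have hat : ∀ t ∈ Ioo (-ε) ε, ContMDiffAt 𝓘(ℝ, ℝ) 𝓘(ℝ, E) ∞ γ t := fun t ht =>
    hγ.contMDiffAt (Ioo_mem_nhds ht.1 ht.2)
  refine ⟨ε, hε, fun s => g • γ s, ?_, fun t ht => ?_, ?_⟩
  · exact (ContMDiffSMul.contMDiff_const_smul (I := 𝓘(ℝ, F)) g).comp_contMDiffOn hγ
  · exact (hEL t ht).smul (F := F) hG g (hat t ht).continuousAt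
  · exact jetExtension_smul (F := F) g ((hat 0 ⟨by linarith, hε⟩).mdifferentiableAt (by simp))

theorem cotangentLift_mem_constraintSet [ContMDiffSMul 𝓘(ℝ, F) 𝓘(ℝ, E) ∞ G Q]
    {l : TangentBundle 𝓘(ℝ, E) Q → ℝ} (hG : IsSymmetryGroup G l) (g : G)
    {p : CotangentBundle E Q} (hp : p ∈ constraintSet l) : cotangentLift g p ∈ constraintSet l := by
  obtain ⟨v, hv, rfl⟩ := hp
  exact ⟨tangentLift g v, tangentLift_mem_initialDataConstraint (F := F) hG g hv,
    legendre_tangentLift (F := F) hG g v⟩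

theorem cotangentLift_mem_constraintSet_iff [ContMDiffSMul 𝓘(ℝ, F) 𝓘(ℝ, E) ∞ G Q]
    {l : TangentBundle 𝓘(ℝ, E) Q → ℝ} (hG : IsSymmetryGroup G l) (g : G)
    {p : CotangentBundle E Q} : cotangentLift g p ∈ constraintSet l ↔ p ∈ constraintSet l := by
  refine ⟨fun h => ?_, cotangentLift_mem_constraintSet (F := F) hG g⟩
  have := cotangentLift_mem_constraintSet (F := F) hG g⁻¹ h
  rwa [← cotangentLift_mul (F := F), inv_mul_cancel, cotangentLift_one] at this

end SymmetricSolutions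

/-! ### Partial derivatives on product manifolds -/

section PartialDerivative

variable {E₁ : Type*} [NormedAddCommGroup E₁] [NormedSpace ℝ E₁] {H₁ : Type*} [TopologicalSpace H₁]
  {I₁ : ModelWithCorners ℝ E₁ H₁} {N : Type*} [TopologicalSpace N] [ChartedSpace H₁ N]
  {E₂ : Type*} [NormedAddCommGroup E₂] [NormedSpace ℝ E₂] {H₂ : Type*} [TopologicalSpace H₂]
  {I₂ : ModelWithCorners ℝ E₂ H₂} {M : Type*} [TopologicalSpace M] [ChartedSpace H₂ M]
  {E₃ : Type*} [NormedAddCommGroup E₃] [NormedSpace ℝ E₃] {H₃ : Type*} [TopologicalSpace H₃]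
  {I₃ : ModelWithCorners ℝ E₃ H₃} {M' : Type*} [TopologicalSpace M'] [ChartedSpace H₃ M']

/-- The partial derivative of a smooth map in a fixed direction depends smoothly on the parameter. -/
theorem ContMDiff.mfderiv_left_apply [IsManifold I₁ ∞ N] [IsManifold I₂ ∞ M] [IsManifold I₃ ∞ M']
    {Φ : N × M → M'} (hΦ : ContMDiff (I₁.prod I₂) I₃ ∞ Φ) (n : N) (ξ : TangentSpace I₁ n) :
    ContMDiff I₂ I₃.tangent ∞ (fun p : M =>
      (⟨Φ (n, p), mfderiv I₁ I₃ (fun g => Φ (g, p)) n ξ⟩ : TangentBundle I₃ M')) := by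
  -- The partial derivative is the tangent map of `Φ` on the vectors `(ξ, 0)`, which form a smooth
  -- family: a constant vector paired with the zero section.
  have s0 : ContMDiff I₂ I₂.tangent ∞ (fun p : M => (⟨p, 0⟩ : TangentBundle I₂ M)) :=
    contMDiff_zeroSection _ _
  have s1 : ContMDiff I₂ I₁.tangent ∞ (fun _ : M => (⟨n, ξ⟩ : TangentBundle I₁ N)) :=
    contMDiff_const
  have s2 : ContMDiff (I₁.tangent.prod I₂.tangent) (I₁.prod I₂).tangent ∞
    (equivTangentBundleProd I₁ N I₂ M).symm := contMDiff_equivTangentBundleProd_symm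
  have s3 : ContMDiff (I₁.prod I₂).tangent I₃.tangent ∞ (tangentMap (I₁.prod I₂) I₃ Φ) :=
    hΦ.contMDiff_tangentMap (by simp)
  have s := (s3.comp s2).comp (s1.prodMk s0)
  convert! s using 2 with p
  have h := mfderiv_prod_eq_add_apply (I := I₁) (I' := I₂) (I'' := I₃) (f := Φ) (p := (n, p))
    (v := (ξ, 0)) (hΦ.mdifferentiableAt (by simp))
  have h' : (mfderiv I₁ I₃ (fun g => Φ (g, p)) n ξ : E₃) =
      (mfderiv (I₁.prod I₂) I₃ Φ (n, p) (ξ, 0) : E₃) := by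
    refine (h.trans ?_).symm
    have h0 : (mfderiv I₂ I₃ (fun z => Φ (n, z)) p (0 : TangentSpace I₂ p) : E₃) = 0 := map_zero _
    let w₀ : E₃ := mfderiv I₁ I₃ (fun g => Φ (g, p)) n ξ
    exact (congrArg (fun w : E₃ => w₀ + w) h0).trans (add_zero w₀)
  exact congrArg (fun w : E₃ => (⟨Φ (n, p), w⟩ : TangentBundle I₃ M')) h'

/-- A chain rule for base points that are equal only propositionally, such as `1 • q` and `q`. -/
theorem mfderiv_apply_mfderiv_of_eq {g : M → M'} {f : N → M} {x : N} {y : M} (hy : f x = y)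
    (hg : MDifferentiableAt I₂ I₃ g y) (hf : MDifferentiableAt I₁ I₂ f x) (v : E₁) :
    (mfderiv I₂ I₃ g y : E₂ →L[ℝ] E₃) ((mfderiv I₁ I₂ f x : E₁ →L[ℝ] E₂) v) =
      (mfderiv I₁ I₃ (fun z => g (f z)) x : E₁ →L[ℝ] E₃) v := by
  subst hy
  exact (congrArg (fun A : E₁ →L[ℝ] E₃ => A v) (mfderiv_comp x hg hf)).symm

end PartialDerivative

/-! ### The momentum map, constraint functions and integral curves -/

section Momentum

variable {E : Type*} [NormedAddCommGroup E] [NormedSpace ℝ E]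
  {Q : Type*} [TopologicalSpace Q] [ChartedSpace E Q] [IsManifold 𝓘(ℝ, E) ∞ Q]
  {F : Type*} [NormedAddCommGroup F] [NormedSpace ℝ F]
  {G : Type*} [TopologicalSpace G] [ChartedSpace F G] [Group G] [MulAction G Q]

theorem contMDiff_cotangentGenerator [LieGroup 𝓘(ℝ, F) ∞ G] [ContMDiffSMul 𝓘(ℝ, F) 𝓘(ℝ, E) ∞ G Q]
    (ξ : GroupLieAlgebra 𝓘(ℝ, F) G) :
    ContMDiff (cotangentModel E) (cotangentModel E).tangent ∞ (fun p : CotangentBundle E Q =>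
      (⟨p, cotangentGenerator ξ p⟩ : TangentBundle (cotangentModel E) (CotangentBundle E Q))) := by
  have h := (contMDiff_cotangentLift (E := E) (Q := Q) (F := F) (G := G)).mfderiv_left_apply
    (1 : G) ξ
  have e : (fun p : CotangentBundle E Q => (⟨p, cotangentGenerator ξ p⟩ :
      TangentBundle (cotangentModel E) (CotangentBundle E Q))) = fun p =>
      (⟨cotangentLift (1 : G) p, cotangentGenerator ξ p⟩ :
        TangentBundle (cotangentModel E) (CotangentBundle E Q)) := by
    funext p
    exact congrArg (fun r => (⟨r, (cotangentGenerator ξ p : E × (E →L[ℝ] ℝ))⟩ :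
        TangentBundle (cotangentModel E) (CotangentBundle E Q))) (cotangentLift_one (G := G) p).symm
  rw [e]
  exact h

/-- The derivative of a function along the generator of the action. -/
theorem mfderiv_cotangentGenerator [LieGroup 𝓘(ℝ, F) ∞ G] [ContMDiffSMul 𝓘(ℝ, F) 𝓘(ℝ, E) ∞ G Q]
    (ξ : GroupLieAlgebra 𝓘(ℝ, F) G) {c : CotangentBundle E Q → ℝ} {p : CotangentBundle E Q}
    (hc : MDifferentiableAt (cotangentModel E) 𝓘(ℝ, ℝ) c p) :
    (mfderiv (cotangentModel E) 𝓘(ℝ, ℝ) c p (cotangentGenerator ξ p) : ℝ) =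
      mfderiv 𝓘(ℝ, F) 𝓘(ℝ, ℝ) (fun g : G => c (cotangentLift g p)) 1 ξ := by
  have hL : MDifferentiableAt 𝓘(ℝ, F) (cotangentModel E) (fun g : G => cotangentLift g p) 1 :=
    ((contMDiff_cotangentLift (E := E) (Q := Q) (F := F) (G := G)).comp
      (contMDiff_id.prodMk contMDiff_const)).mdifferentiableAt (by simp)
  exact mfderiv_apply_mfderiv_of_eq (E₁ := F)
    (f := fun g : G => cotangentLift g p) (cotangentLift_one (G := G) p) hc hL ξ

/-- The bracket is a partial derivative of `(g, p) ↦ c (g • p)`, hence smooth; over `p ∈ 𝓒` the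
differentiated function of `g` is zero because `𝓒` is invariant. -/
theorem poissonBracket_isConstraintFunction [LieGroup 𝓘(ℝ, F) ∞ G]
    [ContMDiffSMul 𝓘(ℝ, F) 𝓘(ℝ, E) ∞ G Q] {l : TangentBundle 𝓘(ℝ, E) Q → ℝ}
    (hG : IsSymmetryGroup G l) (ξ : GroupLieAlgebra 𝓘(ℝ, F) G) {f : CotangentBundle E Q → ℝ}
    (hf : ∀ p, hamiltonianVectorField f p = cotangentGenerator ξ p)
    {c : CotangentBundle E Q → ℝ} (hc : IsConstraintFunction l c) :
    IsConstraintFunction l (poissonBracket f c) := by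
  have e : poissonBracket f c = fun p =>
      -(mfderiv 𝓘(ℝ, F) 𝓘(ℝ, ℝ) (fun g : G => c (cotangentLift g p)) 1 ξ : ℝ) := by
    funext p
    rw [← mfderiv_cotangentGenerator ξ (hc.1.mdifferentiableAt (by simp)), ← hf p]
    rfl
  rw [e]
  constructor
  · have h := (hc.1.comp (contMDiff_cotangentLift (E := E) (Q := Q) (F := F) (G := G))
      ).mfderiv_left_apply (1 : G) ξ
    exact (contMDiff_snd_tangentBundle_modelSpace ℝ 𝓘(ℝ, ℝ) |>.comp h).neg
  · intro p hp
    have h0 : (fun g : G => c (cotangentLift g p)) = fun _ => 0 := funext fun g =>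
      hc.2 _ (cotangentLift_mem_constraintSet (F := F) hG g hp)
    have h1 : (mfderiv 𝓘(ℝ, F) 𝓘(ℝ, ℝ) (fun _ : G => (0 : ℝ)) 1 ξ : ℝ) = 0 := by
      rw [mfderiv_const]; rfl
    have h2 := (congrArg (fun f : G → ℝ => (mfderiv 𝓘(ℝ, F) 𝓘(ℝ, ℝ) f 1 ξ : ℝ)) h0).trans h1
    exact neg_eq_zero.2 h2

/-- The projection intertwines the actions, so it maps the generator on `T^*Q` to the generator on
`Q`. -/
theorem momentum_eq [LieGroup 𝓘(ℝ, F) ∞ G] [ContMDiffSMul 𝓘(ℝ, F) 𝓘(ℝ, E) ∞ G Q]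
    (ξ : GroupLieAlgebra 𝓘(ℝ, F) G) (p : CotangentBundle E Q) :
    momentum ξ p = (p.2 : TangentSpace 𝓘(ℝ, E) p.1 →L[ℝ] ℝ)
      (mfderiv 𝓘(ℝ, F) 𝓘(ℝ, E) (fun g : G => g • p.1) 1 ξ : E) := by
  have hL : MDifferentiableAt 𝓘(ℝ, F) (cotangentModel E) (fun g : G => cotangentLift g p) 1 :=
    ((contMDiff_cotangentLift (E := E) (Q := Q) (F := F) (G := G)).comp
      (contMDiff_id.prodMk contMDiff_const)).mdifferentiableAt (by simp)
  have hπ : MDifferentiableAt (cotangentModel E) 𝓘(ℝ, E) (fun r : CotangentBundle E Q => r.1) p :=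
    (contMDiff_proj _ (n := 1)).mdifferentiableAt one_ne_zero
  exact congrArg (fun w : E => (p.2 : TangentSpace 𝓘(ℝ, E) p.1 →L[ℝ] ℝ) w)
    (mfderiv_apply_mfderiv_of_eq (E₁ := F)
    (f := fun g : G => cotangentLift g p) (cotangentLift_one (G := G) p) hπ hL ξ)

theorem contMDiff_momentum [LieGroup 𝓘(ℝ, F) ∞ G] [ContMDiffSMul 𝓘(ℝ, F) 𝓘(ℝ, E) ∞ G Q]
    (ξ : GroupLieAlgebra 𝓘(ℝ, F) G) :
    ContMDiff (cotangentModel E) 𝓘(ℝ, ℝ) ∞ (momentum ξ : CotangentBundle E Q → ℝ) := by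
  have h1 := (ContMDiffSMul.contMDiff_smul (I := 𝓘(ℝ, F)) (I' := 𝓘(ℝ, E)) (n := ∞) (G := G)
    (M := Q)).mfderiv_left_apply (1 : G) ξ
  have h2 : ContMDiff 𝓘(ℝ, E) 𝓘(ℝ, E).tangent ∞ (fun q : Q =>
      (⟨q, (mfderiv 𝓘(ℝ, F) 𝓘(ℝ, E) (fun g : G => g • q) 1 ξ : E)⟩ : TangentBundle 𝓘(ℝ, E) Q)) := by
    have e : (fun q : Q => (⟨q, (mfderiv 𝓘(ℝ, F) 𝓘(ℝ, E) (fun g : G => g • q) 1 ξ : E)⟩ :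
        TangentBundle 𝓘(ℝ, E) Q)) = fun q => (⟨(1 : G) • q,
        (mfderiv 𝓘(ℝ, F) 𝓘(ℝ, E) (fun g : G => g • q) 1 ξ : E)⟩ : TangentBundle 𝓘(ℝ, E) Q) := by
      funext q
      exact TangentBundle.ext_of_eq (E := E) (one_smul G q).symm rfl
    rw [e]
    exact h1
  have h3 := ContMDiff.clm_bundle_apply (F₁ := E) (E₁ := TangentSpace 𝓘(ℝ, E)) (F₂ := ℝ)
    (E₂ := Bundle.Trivial Q ℝ) (IM := cotangentModel E) (IB := 𝓘(ℝ, E)) (n := ∞)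
    (b := fun p : CotangentBundle E Q => p.1) (ϕ := fun p => p.2)
    (v := fun p => (mfderiv 𝓘(ℝ, F) 𝓘(ℝ, E) (fun g : G => g • p.1) 1 ξ : E))
    contMDiff_id (h2.comp (contMDiff_proj _))
  have h4 : (momentum ξ : CotangentBundle E Q → ℝ) = fun p =>
      (p.2 : TangentSpace 𝓘(ℝ, E) p.1 →L[ℝ] ℝ)
        (mfderiv 𝓘(ℝ, F) 𝓘(ℝ, E) (fun g : G => g • p.1) 1 ξ : E) := funext (momentum_eq ξ)
  rw [h4]
  intro p
  exact (contMDiffAt_totalSpace.1 (h3 p)).2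

/-- Integral curves of the generator of the action are locally orbits of a curve in the group. -/
theorem IsMIntegralCurveAt.eventually_exists_cotangentLift [FiniteDimensional ℝ E]
    [FiniteDimensional ℝ F] [LieGroup 𝓘(ℝ, F) ∞ G]
    [ContMDiffSMul 𝓘(ℝ, F) 𝓘(ℝ, E) ∞ G Q] (ξ : GroupLieAlgebra 𝓘(ℝ, F) G)
    {δ : ℝ → CotangentBundle E Q} {t₀ : ℝ}
    (hδ : IsMIntegralCurveAt (I := cotangentModel E) δ (cotangentGenerator ξ) t₀) :
    ∀ᶠ t in nhds t₀, ∃ g : G, δ t = cotangentLift g (δ t₀) := by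
  -- The right-invariant field with value `ξ` at `1`. Since `(h * γ t) • p = h • (γ t • p)`, its
  -- integral curves act on a point as integral curves of the generator.
  let V : ∀ g : G, TangentSpace 𝓘(ℝ, F) g := fun g =>
    (mfderiv 𝓘(ℝ, F) 𝓘(ℝ, F) (fun h : G => h * g) 1 ξ : F)
  have hV : ContMDiff 𝓘(ℝ, F) 𝓘(ℝ, F).tangent ∞
      (fun g : G => (⟨g, V g⟩ : TangentBundle 𝓘(ℝ, F) G)) := by
    have e : (fun g : G => (⟨g, V g⟩ : TangentBundle 𝓘(ℝ, F) G)) =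
        fun g => (⟨1 * g, (V g : F)⟩ : TangentBundle 𝓘(ℝ, F) G) := by
      funext g
      exact congrArg (fun h => (⟨h, (V g : F)⟩ : TangentBundle 𝓘(ℝ, F) G)) (one_mul g).symm
    rw [e]
    exact (contMDiff_mul 𝓘(ℝ, F) ∞ (G := G)).mfderiv_left_apply (1 : G) ξ
  obtain ⟨γ, hγ₀, hγ⟩ := exists_isMIntegralCurveAt_of_contMDiffAt_boundaryless (I := 𝓘(ℝ, F))
    (v := V) t₀ (x₀ := (1 : G)) ((hV.of_le (by simp)).contMDiffAt)
  have hlift : ∀ p : CotangentBundle E Q,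
      MDifferentiable 𝓘(ℝ, F) (cotangentModel E) (fun g : G => cotangentLift g p) := fun p =>
    ((contMDiff_cotangentLift (E := E) (Q := Q) (F := F) (G := G)).comp
      (contMDiff_id.prodMk contMDiff_const)).mdifferentiable (by simp)
  have horb : IsMIntegralCurveAt (I := cotangentModel E) (fun t => cotangentLift (γ t) (δ t₀))
      (cotangentGenerator ξ) t₀ := by
    filter_upwards [hγ] with t ht
    have h1 := HasMFDerivAt.comp t (hlift (δ t₀) (γ t)).hasMFDerivAt ht
    refine h1.congr_mfderiv ?_
    have h2 := mfderiv_apply_mfderiv_of_eq (E₁ := F) (f := fun h : G => h * γ t)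
      (one_mul (γ t)) (hlift (δ t₀) (γ t))
      ((contMDiff_mul_right (I := 𝓘(ℝ, F)) (n := ∞) (a := γ t)).mdifferentiableAt
        (x := (1 : G)) (by simp)) ξ
    have h3 : (fun g : G => cotangentLift (g * γ t) (δ t₀)) =
        fun g => cotangentLift g (cotangentLift (γ t) (δ t₀)) :=
      funext fun g => cotangentLift_mul (F := F) g (γ t) (δ t₀)
    have h4 := h2.trans (congrArg (fun f : G → CotangentBundle E Q =>
      (mfderiv 𝓘(ℝ, F) (cotangentModel E) f 1 : F →L[ℝ] (E × (E →L[ℝ] ℝ))) ξ) h3)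
    refine ContinuousLinearMap.ext fun s => ?_
    let A : F →L[ℝ] (E × (E →L[ℝ] ℝ)) :=
      mfderiv 𝓘(ℝ, F) (cotangentModel E) (fun g : G => cotangentLift g (δ t₀)) (γ t)
    let s' : ℝ := s
    let w : F := V (γ t)
    exact (A.map_smul s' w).trans (congrArg (fun z : E × (E →L[ℝ] ℝ) => s' • z) h4)
  have hu := isMIntegralCurveAt_eventuallyEq_of_contMDiffAt_boundaryless
    (((contMDiff_cotangentGenerator ξ).of_le (by simp)).contMDiffAt) hδ horb
    (by rw [hγ₀, cotangentLift_one])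
  exact hu.mono fun t ht => ⟨γ t, ht⟩

theorem IsMIntegralCurveOn.mem_constraintSet [FiniteDimensional ℝ E]
    [FiniteDimensional ℝ F] [LieGroup 𝓘(ℝ, F) ∞ G]
    [ContMDiffSMul 𝓘(ℝ, F) 𝓘(ℝ, E) ∞ G Q] {l : TangentBundle 𝓘(ℝ, E) Q → ℝ}
    (hG : IsSymmetryGroup G l) (ξ : GroupLieAlgebra 𝓘(ℝ, F) G) {δ : ℝ → CotangentBundle E Q}
    {a b : ℝ} (hδ : IsMIntegralCurveOn (I := cotangentModel E) δ (cotangentGenerator ξ) (Ioo a b))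
    (hmem : ∃ t ∈ Ioo a b, δ t ∈ constraintSet l) : ∀ t ∈ Ioo a b, δ t ∈ constraintSet l := by
  -- Local constancy in both directions lets connectedness of the interval conclude without
  -- closedness of `𝓒`.
  have hloc : ∀ t ∈ Ioo a b, ∀ᶠ s in nhds t, (δ s ∈ constraintSet l ↔ δ t ∈ constraintSet l) := by
    intro t ht
    filter_upwards [(hδ.isMIntegralCurveAt
      (Ioo_mem_nhds ht.1 ht.2)).eventually_exists_cotangentLift ξ] with s ⟨g, hg⟩
    rw [hg, cotangentLift_mem_constraintSet_iff (F := F) hG]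
  obtain ⟨t₁, ht₁, h₁⟩ := hmem
  intro t ht
  refine (isPreconnected_Ioo.induction₂ (fun x y => δ x ∈ constraintSet l ↔ δ y ∈ constraintSet l)
    (fun x hx => ?_) (fun _ _ _ _ _ _ => Iff.trans) (fun _ _ _ _ => Iff.symm) ht₁ ht).1 h₁
  exact ((hloc x hx).filter_mono nhdsWithin_le_nhds).mono fun y hy => hy.symm

end Momentum

/-! ### Hamilton's equations for a lifted family of maps -/

section LocalComputation

variable {E : Type*} [NormedAddCommGroup E] [NormedSpace ℝ E]
  {F : Type*} [NormedAddCommGroup F] [NormedSpace ℝ F]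

/-- The Hamilton equations of the momentum `y ↦ y.2 (∂ₛΦ(s₀, y.1) ξ)` for the cotangent lift `u` of a
family `Φ` of maps with `Φ(s₀, ·) = id`. -/
theorem hamilton_equations_of_family {Φ : F × E → E} {s₀ : F} {x₀ : E} {η₀ : E →L[ℝ] ℝ}
    (hΦ : ContDiffAt ℝ ∞ Φ (s₀, x₀)) (hid : ∀ᶠ x in nhds x₀, Φ (s₀, x) = x)
    {u : F → E × (E →L[ℝ] ℝ)} {u' : F →L[ℝ] E × (E →L[ℝ] ℝ)} (hu : HasFDerivAt u u' s₀)
    (hu₀ : u s₀ = (x₀, η₀)) (hu₁ : ∀ s, (u s).1 = Φ (s, x₀))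
    (hu₂ : ∀ᶠ s in nhds s₀, ∀ w, (u s).2 (fderiv ℝ (fun x => Φ (s, x)) x₀ w) = η₀ w) (ξ : F)
    {j : E × (E →L[ℝ] ℝ) → ℝ}
    (hj : ∀ᶠ y in nhds (x₀, η₀), j y = y.2 (fderiv ℝ (fun s => Φ (s, y.1)) s₀ ξ))
    (Y : E × (E →L[ℝ] ℝ)) :
    (u' ξ).2 Y.1 - Y.2 (u' ξ).1 = -(fderiv ℝ j (x₀, η₀) Y) := by
  have hdiff : ∀ᶠ z in nhds (s₀, x₀), DifferentiableAt ℝ Φ z :=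
    ((hΦ.of_le (m := 1) (by simp)).eventually (by exact_mod_cast ENat.one_ne_top)).mono
      fun z hz => hz.differentiableAt one_ne_zero
  have hD : HasFDerivAt (fderiv ℝ Φ) (fderiv ℝ (fderiv ℝ Φ) (s₀, x₀)) (s₀, x₀) :=
    ((hΦ.fderiv_right (m := 1)
      (WithTop.coe_le_coe.2 (le_top (a := (1 + 1 : ℕ∞))))).differentiableAt one_ne_zero).hasFDerivAt
  have hsymm : IsSymmSndFDerivAt ℝ Φ (s₀, x₀) := hΦ.isSymmSndFDerivAt
    (by rw [minSmoothness_of_isRCLikeNormedField]; exact WithTop.coe_le_coe.2 le_top)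
  set D := fderiv ℝ (fderiv ℝ Φ) (s₀, x₀)
  have hpx : ∀ z : F × E, DifferentiableAt ℝ Φ z → ∀ w,
      fderiv ℝ (fun x => Φ (z.1, x)) z.2 w = fderiv ℝ Φ z (0, w) := fun z hz w => by
    have := (show HasFDerivAt Φ (fderiv ℝ Φ z) (z.1, z.2) from hz.hasFDerivAt).comp z.2
      (hasFDerivAt_prodMk_right (𝕜 := ℝ) z.1 z.2)
    exact DFunLike.congr_fun this.fderiv w
  have hps : ∀ z : F × E, DifferentiableAt ℝ Φ z → ∀ w,
      fderiv ℝ (fun s => Φ (s, z.2)) z.1 w = fderiv ℝ Φ z (w, 0) := fun z hz w => by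
    have := (show HasFDerivAt Φ (fderiv ℝ Φ z) (z.1, z.2) from hz.hasFDerivAt).comp z.1
      (hasFDerivAt_prodMk_left (𝕜 := ℝ) z.1 z.2)
    exact DFunLike.congr_fun this.fderiv w
  have hz₀ : DifferentiableAt ℝ Φ (s₀, x₀) := hdiff.self_of_nhds
  have h1 : ∀ w, fderiv ℝ Φ (s₀, x₀) (0, w) = w := fun w => by
    rw [← hpx (s₀, x₀) hz₀ w, Filter.EventuallyEq.fderiv_eq (f := fun x => x) hid]
    simp
  have h2 : (u' ξ).1 = fderiv ℝ Φ (s₀, x₀) (ξ, 0) := by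
    rw [← hps (s₀, x₀) hz₀ ξ]
    have := (hasFDerivAt_fst (𝕜 := ℝ) (p := u s₀)).comp s₀ hu
    rw [← funext hu₁, HasFDerivAt.fderiv (f := fun s => (u s).1) this]
    rfl
  have hu2' : HasFDerivAt (fun s => (u s).2) ((ContinuousLinearMap.snd ℝ E (E →L[ℝ] ℝ)).comp u') s₀ :=
    (hasFDerivAt_snd (𝕜 := ℝ) (p := u s₀)).comp s₀ hu
  -- Derivative of the invariant pairing `hu₂` at `s₀`; `∂ₓΦ(s₀, x₀) = id` reduces its first term to
  -- `(u' ξ).2 Y.1`.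
  have h3 : (u' ξ).2 Y.1 + η₀ (D (ξ, 0) (0, Y.1)) = 0 := by
    have e1 : HasFDerivAt (fun s => fderiv ℝ Φ (s, x₀)) (D.comp (ContinuousLinearMap.inl ℝ F E)) s₀ :=
      hD.comp s₀ (hasFDerivAt_prodMk_left s₀ x₀)
    have e2 := hu2'.clm_apply (e1.clm_apply (hasFDerivAt_const ((0 : F), Y.1) s₀))
    have e3 : (fun s => (u s).2 (fderiv ℝ Φ (s, x₀) (0, Y.1))) =ᶠ[nhds s₀] fun _ => η₀ Y.1 := by
      have hc : Filter.Tendsto (fun s : F => (s, x₀)) (nhds s₀) (nhds (s₀, x₀)) :=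
        (Continuous.prodMk_left x₀).continuousAt
      filter_upwards [hu₂, hc.eventually hdiff] with s hs hs'
      rw [← hpx (s, x₀) hs', hs]
    have e4 := DFunLike.congr_fun (e2.unique ((hasFDerivAt_const _ _).congr_of_eventuallyEq e3)) ξ
    simp [h1, hu₀] at e4
    linarith
  have h4 : fderiv ℝ j (x₀, η₀) Y =
      Y.2 (fderiv ℝ Φ (s₀, x₀) (ξ, 0)) + η₀ (D (0, Y.1) (ξ, 0)) := by
    have hc : HasFDerivAt (fun y : E × (E →L[ℝ] ℝ) => (s₀, y.1))
        ((ContinuousLinearMap.inr ℝ F E).comp (ContinuousLinearMap.fst ℝ E (E →L[ℝ] ℝ))) (x₀, η₀) :=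
      (hasFDerivAt_prodMk_right s₀ x₀).comp (x₀, η₀) hasFDerivAt_fst
    have e1 : HasFDerivAt (fun y : E × (E →L[ℝ] ℝ) => fderiv ℝ Φ (s₀, y.1)) _ (x₀, η₀) :=
      HasFDerivAt.comp (x₀, η₀) (g := fderiv ℝ Φ) hD hc
    have e2 := (hasFDerivAt_snd (𝕜 := ℝ) (p := (x₀, η₀))).clm_apply
      (e1.clm_apply (hasFDerivAt_const (ξ, (0 : E)) (x₀, η₀)))
    have e3 : j =ᶠ[nhds (x₀, η₀)] fun y => y.2 (fderiv ℝ Φ (s₀, y.1) (ξ, 0)) := by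
      filter_upwards [hj, hc.continuousAt.eventually hdiff] with y hy hy'
      rw [hy, hps (s₀, y.1) hy']
    rw [(e2.congr_of_eventuallyEq e3).fderiv]
    simp [add_comm]
  -- `h3` and `h4` contain the mixed second derivative in opposite orders; symmetry identifies them.
  rw [h4, h2, hsymm (0, Y.1) (ξ, 0)]
  linarith

end LocalComputation

/-! ### Manifold derivatives as derivatives in charts -/

section ChartDerivatives

variable {E : Type*} [NormedAddCommGroup E] [NormedSpace ℝ E]
  {M : Type*} [TopologicalSpace M] [ChartedSpace E M]
  {V : Type*} [NormedAddCommGroup V] [NormedSpace ℝ V] {H : Type*} [TopologicalSpace H]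
  {J : ModelWithCorners ℝ V H} {M' : Type*} [TopologicalSpace M'] [ChartedSpace H M']

theorem contMDiffAt_extChartAt_symm_self [IsManifold J ∞ M'] [J.Boundaryless]
    {x : M'} {y : V} (hy : y ∈ (extChartAt J x).target) :
    ContMDiffAt 𝓘(ℝ, V) J ∞ (extChartAt J x).symm y :=
  (contMDiffOn_extChartAt_symm x).contMDiffAt ((isOpen_extChartAt_target x).mem_nhds hy)

theorem fderiv_written_eq_mfderiv {H₀ : Type*} [TopologicalSpace H₀] {V₀ : Type*}
    [NormedAddCommGroup V₀] [NormedSpace ℝ V₀] {J₀ : ModelWithCorners ℝ V₀ H₀} [J₀.Boundaryless]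
    {N : Type*} [TopologicalSpace N] [ChartedSpace H₀ N]
    {f : N → M'} {n : N} {m : M'} (hm : f n = m) (hf : MDifferentiableAt J₀ J f n) :
    fderiv ℝ (fun s => extChartAt J m (f ((extChartAt J₀ n).symm s))) (extChartAt J₀ n n) =
      (mfderiv J₀ J f n : V₀ →L[ℝ] V) := by
  subst hm
  have h := hf.mfderiv
  rw [J₀.range_eq_univ, fderivWithin_univ] at h
  exact h.symm

variable [IsManifold 𝓘(ℝ, E) ∞ M]

theorem mfderiv_extChartAt_symm_mfderiv_extChartAt_apply {x y : M} (hy : y ∈ (chartAt E x).source)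
    (w : E) :
    (mfderiv 𝓘(ℝ, E) 𝓘(ℝ, E) (extChartAt 𝓘(ℝ, E) x).symm (extChartAt 𝓘(ℝ, E) x y) : E →L[ℝ] E)
      ((mfderiv 𝓘(ℝ, E) 𝓘(ℝ, E) (extChartAt 𝓘(ℝ, E) x) y : E →L[ℝ] E) w) = w := by
  have h := mfderivWithin_extChartAt_symm_comp_mfderiv_extChartAt' (I := 𝓘(ℝ, E)) (x := x) (y := y)
    (by simpa using hy)
  rw [modelWithCornersSelf_coe, range_id, mfderivWithin_univ] at h
  exact congrArg (fun A : E →L[ℝ] E => A w) h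

end ChartDerivatives

/-! ### The generator of the lifted action is Hamiltonian -/

section HamiltonianGenerator

variable {E : Type*} [NormedAddCommGroup E] [NormedSpace ℝ E]
  {Q : Type*} [TopologicalSpace Q] [ChartedSpace E Q] [IsManifold 𝓘(ℝ, E) ∞ Q]
  {F : Type*} [NormedAddCommGroup F] [NormedSpace ℝ F]
  {G : Type*} [TopologicalSpace G] [ChartedSpace F G] [Group G] [MulAction G Q]

variable (E F G) in
/-- The action read in the preferred charts at `1` and at `q₀`. -/
noncomputable def actionInChart (q₀ : Q) (z : F × E) : E :=
  extChartAt 𝓘(ℝ, E) q₀ ((extChartAt 𝓘(ℝ, F) (1 : G)).symm z.1 • (extChartAt 𝓘(ℝ, E) q₀).symm z.2)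

theorem contDiffAt_actionInChart [LieGroup 𝓘(ℝ, F) ∞ G] [ContMDiffSMul 𝓘(ℝ, F) 𝓘(ℝ, E) ∞ G Q]
    (q₀ : Q) : ContDiffAt ℝ ∞ (actionInChart E F G q₀)
      (extChartAt 𝓘(ℝ, F) (1 : G) 1, extChartAt 𝓘(ℝ, E) q₀ q₀) := by
  rw [← contMDiffAt_iff_contDiffAt]
  have h1 : ContMDiffAt 𝓘(ℝ, F × E) 𝓘(ℝ, F) ∞
      (fun z : F × E => (extChartAt 𝓘(ℝ, F) (1 : G)).symm z.1)
      (extChartAt 𝓘(ℝ, F) (1 : G) 1, extChartAt 𝓘(ℝ, E) q₀ q₀) :=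
    ContMDiffAt.comp _ (contMDiffAt_extChartAt_symm_self (mem_extChartAt_target 1))
      contDiffAt_fst.contMDiffAt
  have h2 : ContMDiffAt 𝓘(ℝ, F × E) 𝓘(ℝ, E) ∞
      (fun z : F × E => (extChartAt 𝓘(ℝ, E) q₀).symm z.2)
      (extChartAt 𝓘(ℝ, F) (1 : G) 1, extChartAt 𝓘(ℝ, E) q₀ q₀) :=
    ContMDiffAt.comp _ (contMDiffAt_extChartAt_symm_self (mem_extChartAt_target q₀))
      contDiffAt_snd.contMDiffAt
  exact ContMDiffAt.comp_of_eq (contMDiffAt_extChartAt (I := 𝓘(ℝ, E)) (x := q₀)) (h1.smul h2)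
    (by simp)

theorem actionInChart_one (q₀ : Q) {x : E} (hx : x ∈ (extChartAt 𝓘(ℝ, E) q₀).target) :
    actionInChart E F G q₀ (extChartAt 𝓘(ℝ, F) (1 : G) 1, x) = x := by
  rw [actionInChart, extChartAt_to_inv, one_smul, (extChartAt 𝓘(ℝ, E) q₀).right_inv hx]

/-- In the coordinates of the bundle chart at `p`, the momentum is `y ↦ y.2 (∂ₛΦ(s₀, y.1) ξ)`. -/
theorem momentum_eq_covectorInChart [LieGroup 𝓘(ℝ, F) ∞ G] [ContMDiffSMul 𝓘(ℝ, F) 𝓘(ℝ, E) ∞ G Q]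
    (ξ : GroupLieAlgebra 𝓘(ℝ, F) G) {q₀ : Q} {p : CotangentBundle E Q}
    (hp : p.1 ∈ (chartAt E q₀).source) :
    momentum ξ p = covectorInChart (E := E) q₀ p.1 p.2
      ((fderiv ℝ (fun s => actionInChart E F G q₀ (s, extChartAt 𝓘(ℝ, E) q₀ p.1))
        (extChartAt 𝓘(ℝ, F) (1 : G) 1)) ξ) := by
  have h1 : (fun s => actionInChart E F G q₀ (s, extChartAt 𝓘(ℝ, E) q₀ p.1)) = fun s =>
      extChartAt 𝓘(ℝ, E) q₀ ((extChartAt 𝓘(ℝ, F) (1 : G)).symm s • p.1) := by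
    funext s
    rw [actionInChart, (extChartAt 𝓘(ℝ, E) q₀).left_inv (by simpa using hp)]
  have hs : MDifferentiableAt 𝓘(ℝ, F) 𝓘(ℝ, E) (fun g : G => g • p.1) 1 :=
    ((ContMDiffSMul.contMDiff_smul (I := 𝓘(ℝ, F)) (I' := 𝓘(ℝ, E)) (n := ∞) (G := G)
      (M := Q)).comp (contMDiff_id.prodMk contMDiff_const)).mdifferentiableAt (by simp)
  have hφ : MDifferentiableAt 𝓘(ℝ, E) 𝓘(ℝ, E) (extChartAt 𝓘(ℝ, E) q₀) p.1 :=
    mdifferentiableAt_extChartAt hp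
  have h2 := mfderiv_apply_mfderiv_of_eq (E₁ := F) (f := fun g : G => g • p.1) (one_smul G p.1)
    hφ hs ξ
  have h3 := fderiv_written_eq_mfderiv (J := 𝓘(ℝ, E)) (J₀ := 𝓘(ℝ, F)) (n := (1 : G))
    (f := fun g : G => extChartAt 𝓘(ℝ, E) q₀ (g • p.1)) rfl
    (MDifferentiableAt.comp_of_eq _ hφ hs (one_smul G p.1))
  rw [h1, momentum_eq]
  let η : E →L[ℝ] ℝ := p.2
  -- The derivative of the chart followed by that of its inverse is inserted between the covector
  -- and `ξ_Q`, to pass to coordinates.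
  have h4 := mfderiv_extChartAt_symm_mfderiv_extChartAt_apply hp
    (mfderiv 𝓘(ℝ, F) 𝓘(ℝ, E) (fun g : G => g • p.1) 1 ξ : E)
  have h5 := h2.trans (DFunLike.congr_fun h3 ξ).symm
  refine (congrArg (fun w : E => η w) h4).symm.trans ?_
  exact congrArg (fun w : E => η ((mfderiv 𝓘(ℝ, E) 𝓘(ℝ, E) (extChartAt 𝓘(ℝ, E) q₀).symm
    (extChartAt 𝓘(ℝ, E) q₀ p.1) : E →L[ℝ] E) w)) h5

/-- The invariance of the pairing of covectors and vectors under the lifted actions, in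
coordinates. -/
theorem covectorInChart_cotangentLift [LieGroup 𝓘(ℝ, F) ∞ G] [ContMDiffSMul 𝓘(ℝ, F) 𝓘(ℝ, E) ∞ G Q]
    (p : CotangentBundle E Q) (s : F)
    (hs : (extChartAt 𝓘(ℝ, F) (1 : G)).symm s • p.1 ∈ (chartAt E p.1).source) (w : E) :
    (extChartAt (cotangentModel E) p (cotangentLift ((extChartAt 𝓘(ℝ, F) (1 : G)).symm s) p)).2
      (fderiv ℝ (fun x => actionInChart E F G p.1 (s, x)) (extChartAt 𝓘(ℝ, E) p.1 p.1) w) =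
      (extChartAt (cotangentModel E) p p).2 w := by
  rw [extChartAt_cotangent_snd (mem_chart_source E p.1),
    extChartAt_cotangent_snd (p := p) (r := cotangentLift _ p) hs]
  set g := (extChartAt 𝓘(ℝ, F) (1 : G)).symm s
  have hφ : MDifferentiableAt 𝓘(ℝ, E) 𝓘(ℝ, E) (extChartAt 𝓘(ℝ, E) p.1) (g • p.1) :=
    mdifferentiableAt_extChartAt hs
  have hψ : MDifferentiableAt 𝓘(ℝ, E) 𝓘(ℝ, E) (extChartAt 𝓘(ℝ, E) p.1).symm
      (extChartAt 𝓘(ℝ, E) p.1 p.1) :=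
    (contMDiffAt_extChartAt_symm_self (mem_extChartAt_target p.1)).mdifferentiableAt (by simp)
  have h1 := mfderiv_apply_mfderiv_of_eq (f := (extChartAt 𝓘(ℝ, E) p.1).symm)
    (extChartAt_to_inv p.1) (mdifferentiable_const_smul (E := E) (F := F) g p.1) hψ w
  have h2 := mfderiv_apply_mfderiv_of_eq (f := fun x => g • (extChartAt 𝓘(ℝ, E) p.1).symm x)
    (x := extChartAt 𝓘(ℝ, E) p.1 p.1) (by rw [extChartAt_to_inv]) hφ
    (MDifferentiableAt.comp_of_eq _ (mdifferentiable_const_smul (E := E) (F := F) g p.1) hψ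
      (extChartAt_to_inv p.1)) w
  have h3 := (congrArg (fun v : E => (mfderiv 𝓘(ℝ, E) 𝓘(ℝ, E) (extChartAt 𝓘(ℝ, E) p.1) (g • p.1) :
    E →L[ℝ] E) v) h1).trans h2
  rw [mfderiv_eq_fderiv] at h3
  let η : E →L[ℝ] ℝ := p.2
  let v : E := (mfderiv 𝓘(ℝ, E) 𝓘(ℝ, E) (extChartAt 𝓘(ℝ, E) p.1).symm
      (extChartAt 𝓘(ℝ, E) p.1 p.1) : E →L[ℝ] E) w
  -- Two cancellations give the invariance: the chart derivatives at `g • p.1`, then `Dg⁻¹` against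
  -- `Dg`.
  have h4 := mfderiv_extChartAt_symm_mfderiv_extChartAt_apply hs (smulDeriv (E := E) g p.1 v)
  have h5 := (smulDerivEquiv (E := E) (F := F) g p.1).symm_apply_apply v
  refine (congrArg (fun z : E => η (smulDeriv (E := E) g⁻¹ (g • p.1)
    ((mfderiv 𝓘(ℝ, E) 𝓘(ℝ, E) (extChartAt 𝓘(ℝ, E) p.1).symm
      (extChartAt 𝓘(ℝ, E) p.1 (g • p.1)) : E →L[ℝ] E) z))) h3).symm.trans ?_
  refine (congrArg (fun z : E => η (smulDeriv (E := E) g⁻¹ (g • p.1) z)) h4).trans ?_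
  exact congrArg η h5

theorem hamiltonianVectorField_momentum [FiniteDimensional ℝ E] [LieGroup 𝓘(ℝ, F) ∞ G]
    [ContMDiffSMul 𝓘(ℝ, F) 𝓘(ℝ, E) ∞ G Q] (ξ : GroupLieAlgebra 𝓘(ℝ, F) G)
    (p : CotangentBundle E Q) :
    hamiltonianVectorField (momentum ξ) p = cotangentGenerator ξ p := by
  have hL : MDifferentiable 𝓘(ℝ, F) (cotangentModel E) (fun g : G => cotangentLift g p) :=
    ((contMDiff_cotangentLift (E := E) (Q := Q) (F := F) (G := G)).comp
      (contMDiff_id.prodMk contMDiff_const)).mdifferentiable (by simp)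
  let κ := extChartAt 𝓘(ℝ, F) (1 : G)
  let χ := extChartAt (cotangentModel E) p
  have hχ : DifferentiableAt ℝ (fun s => χ (cotangentLift (κ.symm s) p)) (κ 1) := by
    have h1 : MDifferentiableAt 𝓘(ℝ, F) 𝓘(ℝ, F) κ.symm (κ 1) :=
      (contMDiffAt_extChartAt_symm_self (mem_extChartAt_target 1)).mdifferentiableAt (by simp)
    have h2 : MDifferentiableAt (cotangentModel E) 𝓘(ℝ, E × (E →L[ℝ] ℝ)) χ p :=
      mdifferentiableAt_extChartAt (mem_chart_source _ p)
    have h3 : MDifferentiableAt 𝓘(ℝ, F) (cotangentModel E)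
        (fun s => cotangentLift (κ.symm s) p) (κ 1) :=
      MDifferentiableAt.comp (κ 1) (hL (κ.symm (κ 1))) h1
    exact (MDifferentiableAt.comp_of_eq _ h2 h3
      (by rw [extChartAt_to_inv, cotangentLift_one])).differentiableAt
  have hgen := fderiv_written_eq_mfderiv (f := fun g : G => cotangentLift g p)
    (cotangentLift_one (G := G) p) (hL 1)
  have hmom := fderiv_written_eq_mfderiv (J := 𝓘(ℝ, ℝ)) rfl
    ((contMDiff_momentum ξ).mdifferentiableAt (x := p) (by simp))
  apply hamiltonianVectorField_eq
  intro Y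
  -- `Φ` is the action in charts, `u` the orbit of `p` in bundle coordinates and `j` the momentum in
  -- the same coordinates.
  have h := hamilton_equations_of_family (contDiffAt_actionInChart (F := F) (G := G) p.1)
    (η₀ := (χ p).2) ?_ hχ.hasFDerivAt ?_ ?_ ?_ ξ (j := fun y => momentum ξ (χ.symm y)) ?_ Y
  · have e1 : (fderiv ℝ (fun s => χ (cotangentLift (κ.symm s) p)) (κ 1)) ξ =
        (cotangentGenerator ξ p : E × (E →L[ℝ] ℝ)) := DFunLike.congr_fun hgen ξ
    have e2 : fderiv ℝ (fun y => momentum ξ (χ.symm y)) (extChartAt 𝓘(ℝ, E) p.1 p.1, (χ p).2) Y =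
        (mfderiv (cotangentModel E) 𝓘(ℝ, ℝ) (momentum ξ) p : (E × (E →L[ℝ] ℝ)) →L[ℝ] ℝ) Y :=
      DFunLike.congr_fun hmom Y
    rw [e1, e2] at h
    exact h
  · filter_upwards [extChartAt_target_mem_nhds p.1] with x hx using actionInChart_one p.1 hx
  · rw [extChartAt_to_inv, cotangentLift_one]; rfl
  · intro s
    rw [actionInChart, extChartAt_to_inv]; rfl
  · have hc : ContinuousAt (fun s => κ.symm s • p.1) (κ 1) := by
      have h1 : ContinuousAt κ.symm (κ 1) := continuousAt_extChartAt_symm 1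
      have h2 : Continuous (fun g : G => g • p.1) :=
        ((ContMDiffSMul.contMDiff_smul (I := 𝓘(ℝ, F)) (I' := 𝓘(ℝ, E)) (n := ∞) (G := G)
          (M := Q)).comp (contMDiff_id.prodMk contMDiff_const)).continuous
      exact h2.continuousAt.comp h1
    have h1 : κ.symm (κ 1) • p.1 = p.1 := by rw [extChartAt_to_inv, one_smul]
    filter_upwards [hc.preimage_mem_nhds ((chartAt E p.1).open_source.mem_nhds
      (by rw [h1]; exact mem_chart_source E p.1))] with s hs w
    exact covectorInChart_cotangentLift p s hs w
  · filter_upwards [extChartAt_target_mem_nhds (I := cotangentModel E) p] with y hy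
    have h1 := mem_extChartAt_cotangent_source.1 (χ.map_target hy)
    have h2 := momentum_eq_covectorInChart ξ h1
    rw [← extChartAt_cotangent_snd h1, ← extChartAt_cotangent_fst,
      (extChartAt (cotangentModel E) p).right_inv hy] at h2
    exact h2

end HamiltonianGenerator

theorem mainTheorem7
    {E : Type*} [NormedAddCommGroup E] [NormedSpace ℝ E] [FiniteDimensional ℝ E]
    {Q : Type*} [TopologicalSpace Q] [T2Space Q] [ChartedSpace E Q] [IsManifold 𝓘(ℝ, E) ∞ Q]
    {F : Type*} [NormedAddCommGroup F] [NormedSpace ℝ F] [FiniteDimensional ℝ F]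
    {G : Type*} [TopologicalSpace G] [ChartedSpace F G] [Group G] [LieGroup 𝓘(ℝ, F) ∞ G]
    [MulAction G Q] [ContMDiffSMul 𝓘(ℝ, F) 𝓘(ℝ, E) ∞ G Q]
    (l : TangentBundle 𝓘(ℝ, E) Q → ℝ) (hl : ContMDiff 𝓘(ℝ, E).tangent 𝓘(ℝ, ℝ) ∞ l)
    (hG : IsSymmetryGroup G l) (ξ : GroupLieAlgebra 𝓘(ℝ, F) G) :
    -- the generator of the action of `ξ` on the cotangent bundle is the field `X_{j_ξ}`
    (∀ p : CotangentBundle E Q, hamiltonianVectorField (momentum ξ) p = cotangentGenerator ξ p) ∧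
    -- `j_ξ` is a first class function
    IsFirstClass l (momentum ξ) ∧
    -- the flow of `X_{j_ξ}` preserves the constraint set
    (∀ (δ : ℝ → CotangentBundle E Q) (a b : ℝ),
      IsMIntegralCurveOn (I := cotangentModel E) δ (hamiltonianVectorField (momentum ξ)) (Ioo a b) →
      (∃ t ∈ Ioo a b, δ t ∈ constraintSet l) → ∀ t ∈ Ioo a b, δ t ∈ constraintSet l) := by
  have hX : ∀ p : CotangentBundle E Q,
      hamiltonianVectorField (momentum ξ) p = cotangentGenerator ξ p :=
    hamiltonianVectorField_momentum ξ
  refine ⟨hX, ⟨contMDiff_momentum ξ, fun c hc => poissonBracket_isConstraintFunction hG ξ hX hc⟩,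
    fun δ a b hδ hmem => ?_⟩
  rw [show hamiltonianVectorField (momentum ξ) = cotangentGenerator ξ from funext hX] at hδ
  exact hδ.mem_constraintSet hG ξ hmem
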